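/- Let $\kappa$ be a regular (infinite) cardinal and let $\wp_\kappa(\kappa^+)=\{X\subseteq\kappa^+: |X|<\kappa\}$. For a family $\mu$ of sets put $\mu|X=\{Y\in\mu: Y\subsetneq X\}$. For sets of ordinals, $A<B$ means that $a<b$ for all $a\in A$, $b\in B$; and $X=X_1*X_2$ means that $X_1,X_2$ have the same order type, $X_1\cap X_2<X_1\setminus X_2<X_2\setminus X_1$ and $X=X_1\cup X_2$. If $X,Y$ are sets of ordinals of the same order type, $f_{YX}:X\to Y$ is the order isomorphism. A $(\kappa,\kappa^+)$-cardinal is a family $\mu\subseteq\wp_\kappa(\kappa^+)$ such that: 1. $\mu$ is well-founded under inclusion (rank below refers to $(\mu,\subsetneq)$); 2. $|\mu|X|<\kappa$ for all $X\in\mu$; 3. if $X,Y\in\mu$ have the same rank, then they have the same order type and $\mu|Y=\{f_{YX}[Z]: Z\in\mu|X\}$; 4. $\mu$ is directed under inclusion; 5. for every $X\in\mu$, either $\mu|X$ is directed, or there are $X_1,X_2\in\mu$ of the same rank with $X=X_1*X_2$ and $\mu|X=(\mu|X_1)\cup(\mu|X_2)\cup\{X_1,X_2\}$; 6. $\bigcup\mu=\kappa^+$;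 7. $X=\bigcup(\mu|X)$ for every $X\in\mu$ of nonzero rank. It is stationary if it meets every $C\subseteq\wp_\kappa(\kappa^+)$ that is cofinal in $\wp_\kappa(\kappa^+)$ and closed under unions of nonempty chains with fewer than $\kappa$ members. For $\alpha<\kappa^+$ and $\xi<\kappa$ let $\mu_\xi(\alpha)=X\cap\alpha$, where $X$ is any element of $\mu$ of rank $\xi$ with $\alpha\in X$ (such an $X$ exists and the result does not depend on its choice), let $f_\alpha(\xi)$ be the order type of $\mu_\xi(\alpha)$, and let $$T_\mu=\{f_\alpha\restriction\xi:\ \alpha<\kappa^+,\ \xi<\kappa\},$$ ordered by end-extension of functions. A $\kappa$-tree is a tree of height $\kappa$ all of whose levels have cardinality less than $\kappa$; a branch is a maximal chain, and its length is its order type. A $\kappa$-Kurepa tree is a $\kappa$-tree with at least $\kappa^+$ branches of length $\kappa$; a $\kappa$-Aronszajn tree is a $\kappa$-tree with no branch of length $\kappa$. **Theorem.** If $\kappa$ is a regular cardinal and $\mu$ is a stationary $(\kappa,\kappa^+)$-cardinal, then $T_\mu$ is a $\kappa$-Kurepa tree, it has exactly $\kappa^+$ branches of length $\kappa$, and no subset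 of $T_\mu$ with the induced order is a $\kappa$-Aronszajn tree. -/

import Mathlib

open Cardinal Ordinal

universe u v

noncomputable section

namespace TwoCardinal

/-! ### Trees -/

section Trees

variable {P : Type v} [PartialOrder P]

/-- A set `T` with the induced order is a tree: the predecessors in `T` of every element of `T` are
well-ordered. -/
def IsTree (T : Set P) : Prop :=
  ∀ t ∈ T, IsChain (· ≤ ·) {s | s ∈ T ∧ s < t} ∧ {s | s ∈ T ∧ s < t}.IsWF

/-- The `ξ`-th level of `T`: the elements of `T` whose set of predecessors in `T` has order
type `ξ`. -/
def level (T : Set P) (ξ : Ordinal.{u}) : Set P :=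
  {t | t ∈ T ∧ Nonempty ({s | s ∈ T ∧ s < t} ≃o Set.Iio ξ)}

/-- `T` is a `κ`-tree: a tree of height `κ` all of whose levels have fewer than `κ` elements. -/
structure IsKappaTree (κ : Cardinal.{u}) (T : Set P) : Prop where
  tree : IsTree T
  height_le : ∀ t ∈ T, ∃ ξ < κ.ord, t ∈ level T ξ
  le_height : ∀ ξ < κ.ord, (level T ξ).Nonempty
  level_small : ∀ ξ < κ.ord,
    Cardinal.lift.{u, v} #(level T ξ) < Cardinal.lift.{v, u} κ

/-- `b` is a branch of `T` (a maximal chain) of length (order type) `κ`. -/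
structure IsBranch (κ : Cardinal.{u}) (T : Set P) (b : Set P) : Prop where
  subset : b ⊆ T
  chain : IsChain (· ≤ ·) b
  maximal : ∀ c ⊆ T, IsChain (· ≤ ·) c → b ⊆ c → c = b
  length : Nonempty (b ≃o Set.Iio κ.ord)

/-- A `κ`-Kurepa tree: a `κ`-tree with at least `κ⁺` branches of length `κ`. -/
structure IsKurepaTree (κ : Cardinal.{u}) (T : Set P) : Prop extends IsKappaTree κ T where
  many_branches : Cardinal.lift.{v, u} (Order.succ κ) ≤
    Cardinal.lift.{u, v} #{b : Set P | IsBranch κ T b}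

/-- A `κ`-Aronszajn tree: a `κ`-tree without branches of length `κ`. -/
structure IsAronszajnTree (κ : Cardinal.{u}) (T : Set P) : Prop extends IsKappaTree κ T where
  no_branch : ∀ b : Set P, ¬ IsBranch κ T b

end Trees

/-! ### Stationary subsets of `℘_κ(A)` -/

section Stationary

variable {A : Type u}

/-- `℘_κ(A)`, the family of all subsets of `A` with fewer than `κ` elements. -/
def smallSubsets (κ : Cardinal.{u}) (A : Type u) : Set (Set A) := {X | #X < κ}

/-- `C` is closed unbounded in `℘_κ(A)`: it is cofinal, and closed under unions of nonempty
chains with fewer than `κ` members. -/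
structure IsClubFamily (κ : Cardinal.{u}) (C : Set (Set A)) : Prop where
  subset : C ⊆ smallSubsets κ A
  unbounded : ∀ X ∈ smallSubsets κ A, ∃ Y ∈ C, X ⊆ Y
  closed : ∀ c ⊆ C, c.Nonempty → IsChain (· ⊆ ·) c → #c < κ → ⋃₀ c ∈ C

/-- `S` is a stationary subset of `℘_κ(A)`. -/
def IsStationaryFamily (κ : Cardinal.{u}) (S : Set (Set A)) : Prop :=
  S ⊆ smallSubsets κ A ∧ ∀ C : Set (Set A), IsClubFamily κ C → (S ∩ C).Nonempty

end Stationary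

/-! ### `(κ, κ⁺)`-cardinals -/

/-- The well-ordered set `κ⁺` (a well-order of type `κ⁺`). -/
abbrev SuccOrd (κ : Cardinal.{u}) : Type u := (Order.succ κ).ord.ToType

section Families

variable {K : Type u} [LinearOrder K] [WellFoundedLT K]

/-- The order type of a subset of a well-order. -/
def ordtp (X : Set K) : Ordinal.{u} := typeLT X

/-- `A < B` for sets: every element of `A` is below every element of `B`. -/
def SetLT (A B : Set K) : Prop := ∀ a ∈ A, ∀ b ∈ B, a < b

/-- `X = X₁ * X₂`: the sets `X₁`, `X₂` have the same order type,
`X₁ ∩ X₂ < X₁ \ X₂ < X₂ \ X₁`, and `X = X₁ ∪ X₂`. -/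
def IsStar (X X₁ X₂ : Set K) : Prop :=
  ordtp X₁ = ordtp X₂ ∧ SetLT (X₁ ∩ X₂) (X₁ \ X₂) ∧ SetLT (X₁ \ X₂) (X₂ \ X₁) ∧ X = X₁ ∪ X₂

/-- `μ | X`, the members of `μ` strictly included in `X`. -/
def below (μ : Set (Set K)) (X : Set K) : Set (Set K) := {Y | Y ∈ μ ∧ Y ⊂ X}

/-- `e[Z]` for a map `e : X → Y` between sets and `Z ⊆ X`. -/
def imageOf {X Y : Set K} (e : X → Y) (Z : Set K) : Set K :=
  {y | ∃ x : X, (x : K) ∈ Z ∧ (e x : K) = y}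

/-- The rank of `X` in the family `μ` well-founded under inclusion:
`rank X = sup {rank Y + 1 | Y ∈ μ, Y ⊂ X}`. -/
def rank {μ : Set (Set K)} (wf : WellFounded fun X Y : μ => (X : Set K) ⊂ (Y : Set K))
    (X : μ) : Ordinal.{u} := (wf.apply X).rank

end Families

/-- `μ` is a `(κ, κ⁺)`-cardinal (a neat simplified `(κ, 1)`-morass). -/
structure IsTwoCardinal (κ : Cardinal.{u}) (μ : Set (Set (SuccOrd κ))) : Prop where
  small : μ ⊆ smallSubsets κ (SuccOrd κ)
  wf : WellFounded fun X Y : μ => (X : Set (SuccOrd κ)) ⊂ (Y : Set (SuccOrd κ))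
  locally_small : ∀ X ∈ μ, #(below μ X) < κ
  /-- An order isomorphism `X ≃o Y` is unique: it is the map `f_{YX}`. -/
  homogeneous : ∀ X Y : μ, rank wf X = rank wf Y →
    ∃ f : (X : Set (SuccOrd κ)) ≃o (Y : Set (SuccOrd κ)),
      below μ Y = {W | ∃ Z ∈ below μ X, W = imageOf f Z}
  directed : DirectedOn (· ⊆ ·) μ
  locally_almost_directed : ∀ X : μ, DirectedOn (· ⊆ ·) (below μ (X : Set (SuccOrd κ))) ∨
    ∃ X₁ X₂ : μ, rank wf X₁ = rank wf X₂ ∧ IsStar (X : Set (SuccOrd κ)) X₁ X₂ ∧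
      below μ (X : Set (SuccOrd κ)) =
        below μ (X₁ : Set (SuccOrd κ)) ∪ below μ (X₂ : Set (SuccOrd κ)) ∪
          {(X₁ : Set (SuccOrd κ)), (X₂ : Set (SuccOrd κ))}
  covers : ⋃₀ μ = Set.univ
  neat : ∀ X : μ, rank wf X ≠ 0 →
    (X : Set (SuccOrd κ)) = ⋃₀ below μ (X : Set (SuccOrd κ))

/-- A stationary `(κ, κ⁺)`-cardinal. -/
structure IsStationaryTwoCardinal (κ : Cardinal.{u}) (μ : Set (Set (SuccOrd κ))) : Prop
    extends IsTwoCardinal κ μ where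
  stationary : IsStationaryFamily κ μ

section KurepaTree

variable {κ : Cardinal.{u}} {μ : Set (Set (SuccOrd κ))}

/-- The term `μ_ξ(α)` of the `μ`-sequence at `α`: it is `X ∩ α` for any `X ∈ μ` of rank `ξ` with
`α ∈ X`. All such `X` give the same set, so the union over all of them is taken. -/
def muSeq (h : IsTwoCardinal κ μ) (ξ : Ordinal.{u}) (α : SuccOrd κ) : Set (SuccOrd κ) :=
  {β | ∃ X : μ, rank h.wf X = ξ ∧ α ∈ (X : Set (SuccOrd κ)) ∧
    β ∈ (X : Set (SuccOrd κ)) ∩ Set.Iio α}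

/-- The function `f_α(ξ) = ordtp (μ_ξ(α))`. -/
def kurepaFun (h : IsTwoCardinal κ μ) (α : SuccOrd κ) (ξ : Ordinal.{u}) : Ordinal.{u} :=
  ordtp (muSeq h ξ α)

/-- The restriction `f ↾ ξ`, as a set of ordered pairs. For such restrictions, inclusion of sets of
pairs is end-extension of functions. -/
def restr (f : Ordinal.{u} → Ordinal.{u}) (ξ : Ordinal.{u}) : Set (Ordinal.{u} × Ordinal.{u}) :=
  {p | p.1 < ξ ∧ p.2 = f p.1}

/-- The tree `T = {f_α ↾ ξ : α < κ⁺, ξ < κ}`, ordered by inclusion (end-extension). -/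
def kurepaTree (h : IsTwoCardinal κ μ) : Set (Set (Ordinal.{u} × Ordinal.{u})) :=
  {t | ∃ α : SuccOrd κ, ∃ ξ < κ.ord, t = restr (kurepaFun h α) ξ}

end KurepaTree

end TwoCardinal

end

/-!
Write `f_α` for `kurepaFun h α`. By coherence (`IsTwoCardinal.inter_Iio_eq`), `f_α ξ` is the place of
`α` in any member of rank `ξ` that contains `α`. By homogeneity this place determines `f_α` below
`ξ` (`kurepaFun_eq_of_le`), so a single member `X` of rank `ξ` represents all functions: every `f_β`
agrees up to `ξ` with some `f_α`, `α ∈ X` (`exists_mem_kurepaFun_eq`). As `X` has fewer than `κ`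
elements, the levels of the tree are small. Two points of a common member `X` occupy different
places in `X`, so the functions `f_α` are distinct (`path_injective`) and give `κ⁺` branches.

Stationarity serves two purposes. It makes `μ` cofinal among the small sets, so that every point
lies in members of every rank below `κ`. It also yields, for each `φ : κ⁺ → κ`, a member `X` whose
rank bounds `φ` on `X` (`exists_forall_mem_le_rank`). From this it follows that every `κ`-tree `A`
included in the tree contains restrictions of some single `f_α` of unboundedly many lengths
(`exists_unbounded_restr_mem`): given bounds `ψ α < κ` for the restrictions of `f_α` in `A`, choose
`X`, of rank `δ`, such that for `α ∈ X` level `ψ α` of `A` has only elements of length at most `δ`.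
An element of `A` on level `δ` agrees up to `δ` with some `f_α`, `α ∈ X`, and then its predecessor on
level `ψ α` contradicts the bound `ψ α`.

Hence `A` has a branch of length `κ`, so there is no Aronszajn subtree. A branch of length `κ` is
itself a `κ`-tree, so the same statement shows that it consists of the restrictions of some `f_α`,
and there are exactly `κ⁺` branches.

The club behind `exists_forall_mem_le_rank` is obtained by closing off in `ω` steps, which needs `κ`
uncountable. For `κ = ω` every cofinal family of finite sets is a club, and no stationary
`(ω, ω₁)`-cardinal exists (`ne_aleph0`).
-/

namespace TwoCardinal

/-! ### Order types of sections and their transport -/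

theorem imageOf_subset {K : Type u} {X Y : Set K} (e : X → Y) (Z : Set K) : imageOf e Z ⊆ Y := by
  rintro _ ⟨x, -, rfl⟩
  exact (e x).2

section Images

variable {K : Type u} [LinearOrder K]

theorem mem_imageOf_iff {X Y : Set K} (e : X ≃o Y) {Z : Set K} (x : X) :
    (e x : K) ∈ imageOf e Z ↔ (x : K) ∈ Z := by
  refine ⟨?_, fun hx => ⟨x, hx, rfl⟩⟩
  rintro ⟨x', hx', hxx'⟩
  rwa [← e.injective (Subtype.ext hxx')]

theorem imageOf_self {X Y : Set K} (e : X ≃o Y) : imageOf e X = Y :=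
  (imageOf_subset e X).antisymm fun y hy =>
    ⟨e.symm ⟨y, hy⟩, (e.symm ⟨y, hy⟩).2, by simp⟩

theorem imageOf_subset_imageOf_iff {X Y : Set K} (e : X ≃o Y) {Z W : Set K} (hZ : Z ⊆ X) :
    imageOf e Z ⊆ imageOf e W ↔ Z ⊆ W := by
  constructor
  · exact fun h z hz => (mem_imageOf_iff e ⟨z, hZ hz⟩).1 (h ((mem_imageOf_iff e _).2 hz))
  · rintro h _ ⟨x, hx, rfl⟩
    exact ⟨x, h hx, rfl⟩

theorem imageOf_ssubset_imageOf_iff {X Y : Set K} (e : X ≃o Y) {Z W : Set K} (hZ : Z ⊆ X)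
    (hW : W ⊆ X) : imageOf e Z ⊂ imageOf e W ↔ Z ⊂ W := by
  rw [ssubset_iff_subset_not_subset, ssubset_iff_subset_not_subset,
    imageOf_subset_imageOf_iff e hZ, imageOf_subset_imageOf_iff e hW]

end Images

section Sections

variable {K : Type u} [LinearOrder K] [WellFoundedLT K]

theorem ordtp_inter_Iio_eq_typein {X : Set K} (a : X) :
    ordtp (X ∩ Set.Iio (a : K)) = typein (α := X) (· < ·) a := by
  rw [← type_Iio_lt]
  refine type_eq.2 ⟨OrderIso.toRelIsoLT
    { toFun := fun x => ⟨⟨x, x.2.1⟩, x.2.2⟩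
      invFun := fun x => ⟨x.1, x.1.2, x.2⟩
      left_inv := fun _ => rfl
      right_inv := fun _ => rfl
      map_rel_iff' := Iff.rfl }⟩

theorem ordtp_inter_Iio_lt_iff {X : Set K} {a b : K} (ha : a ∈ X) (hb : b ∈ X) :
    ordtp (X ∩ Set.Iio a) < ordtp (X ∩ Set.Iio b) ↔ a < b := by
  rw [ordtp_inter_Iio_eq_typein ⟨a, ha⟩, ordtp_inter_Iio_eq_typein ⟨b, hb⟩, typein_lt_typein]
  rfl

theorem eq_of_ordtp_inter_Iio_eq {X : Set K} {a b : K} (ha : a ∈ X) (hb : b ∈ X)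
    (h : ordtp (X ∩ Set.Iio a) = ordtp (X ∩ Set.Iio b)) : a = b := by
  apply le_antisymm <;> rw [← not_lt]
  · exact fun hlt => ((ordtp_inter_Iio_lt_iff hb ha).2 hlt).ne h.symm
  · exact fun hlt => ((ordtp_inter_Iio_lt_iff ha hb).2 hlt).ne h

theorem ordtp_imageOf_inter_Iio {X Y : Set K} (e : X ≃o Y) {Z : Set K} (hZ : Z ⊆ X) (a : X) :
    ordtp (imageOf e Z ∩ Set.Iio (e a : K)) = ordtp (Z ∩ Set.Iio (a : K)) := by
  refine (type_eq.2 ⟨OrderIso.toRelIsoLT (StrictMono.orderIsoOfSurjective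
    (fun z : (Z ∩ Set.Iio (a : K) : Set K) =>
      (⟨e ⟨z, hZ z.2.1⟩, ⟨_, z.2.1, rfl⟩, e.lt_iff_lt.2 z.2.2⟩ :
        (imageOf e Z ∩ Set.Iio (e a : K) : Set K))) ?_ ?_)⟩).symm
  · exact fun x y hxy => e.lt_iff_lt.2 hxy
  · rintro ⟨_, ⟨x, hx, rfl⟩, hlt⟩
    exact ⟨⟨x, hx, e.lt_iff_lt.1 hlt⟩, rfl⟩

theorem ordtp_inter_Iio_apply {X Y : Set K} (e : X ≃o Y) (a : X) :
    ordtp (Y ∩ Set.Iio (e a : K)) = ordtp (X ∩ Set.Iio (a : K)) := by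
  have h := ordtp_imageOf_inter_Iio e subset_rfl a
  rwa [imageOf_self] at h

theorem orderIso_apply_eq {X Y : Set K} (e : X ≃o Y) {a b : K} (ha : a ∈ X) (hb : b ∈ Y)
    (h : ordtp (X ∩ Set.Iio a) = ordtp (Y ∩ Set.Iio b)) : (e ⟨a, ha⟩ : K) = b :=
  eq_of_ordtp_inter_Iio_eq (e _).2 hb ((ordtp_inter_Iio_apply e ⟨a, ha⟩).trans h)

end Sections

namespace IsTwoCardinal

variable {κ : Cardinal.{u}} {μ : Set (Set (SuccOrd κ))}

/-! ### Ranks -/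

theorem rank_lt_rank (h : IsTwoCardinal κ μ) {X Y : μ}
    (hXY : (X : Set (SuccOrd κ)) ⊂ (Y : Set (SuccOrd κ))) : rank h.wf X < rank h.wf Y :=
  (h.wf.apply Y).rank_lt_of_rel hXY

theorem rank_mono (h : IsTwoCardinal κ μ) {X Y : μ}
    (hXY : (X : Set (SuccOrd κ)) ⊆ (Y : Set (SuccOrd κ))) : rank h.wf X ≤ rank h.wf Y := by
  rcases hXY.eq_or_ssubset with heq | hss
  · rw [Subtype.ext heq]
  · exact (h.rank_lt_rank hss).le

theorem eq_of_subset_of_rank_eq (h : IsTwoCardinal κ μ) {X Y : μ}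
    (hXY : (X : Set (SuccOrd κ)) ⊆ (Y : Set (SuccOrd κ))) (hr : rank h.wf X = rank h.wf Y) :
    X = Y := by
  rcases hXY.eq_or_ssubset with heq | hss
  · exact Subtype.ext heq
  · exact absurd hr (h.rank_lt_rank hss).ne

theorem rank_le_iff (h : IsTwoCardinal κ μ) {X : μ} {o : Ordinal.{u}} :
    rank h.wf X ≤ o ↔
      ∀ Y : μ, (Y : Set (SuccOrd κ)) ⊂ (X : Set (SuccOrd κ)) → rank h.wf Y < o := by
  rw [rank, Acc.rank_eq, Ordinal.iSup_le_iff]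
  simp only [Order.succ_le_iff, Subtype.forall]
  rfl

theorem rank_lt_ord (hκ : κ.IsRegular) (h : IsTwoCardinal κ μ) (X : μ) :
    rank h.wf X < κ.ord := by
  induction X using h.wf.induction with
  | _ X ih =>
    rw [rank, Acc.rank_eq]
    refine Ordinal.iSup_lt_of_lt_cof ?_ fun Y => ?_
    · rw [hκ.cof_ord]
      refine lt_of_le_of_lt ?_ (h.locally_small X X.2)
      exact mk_le_of_injective
        (f := fun Y : {Y : μ // (Y : Set (SuccOrd κ)) ⊂ (X : Set (SuccOrd κ))} =>
          (⟨Y.1, Y.1.2, Y.2⟩ : below μ (X : Set (SuccOrd κ))))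
        fun Y Z hYZ => Subtype.ext (Subtype.ext (congrArg (fun W => W.1) hYZ))
    · exact (isSuccLimit_ord hκ.aleph0_le).succ_lt (ih Y.1 Y.2)

/-- The order isomorphism between two members of the same rank carries the members below the one
to members below the other, and preserves their ranks. -/
theorem exists_transport (h : IsTwoCardinal κ μ) {X Y : μ} (hr : rank h.wf X = rank h.wf Y) :
    ∃ f : (X : Set (SuccOrd κ)) ≃o (Y : Set (SuccOrd κ)),
      ∀ Z : μ, (Z : Set (SuccOrd κ)) ⊆ X →
        ∃ W : μ, (W : Set (SuccOrd κ)) = imageOf f Z ∧ rank h.wf W = rank h.wf Z := by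
  obtain ⟨f, hf⟩ := h.homogeneous X Y hr
  refine ⟨f, fun Z => ?_⟩
  induction Z using h.wf.induction with
  | _ Z ih =>
    intro hZX
    rcases hZX.eq_or_ssubset with heq | hss
    · exact ⟨Y, by rw [heq, imageOf_self], by rw [← hr, Subtype.ext heq]⟩
    have hW : imageOf f (Z : Set (SuccOrd κ)) ∈ below μ (Y : Set (SuccOrd κ)) :=
      hf ▸ ⟨Z, ⟨Z.2, hss⟩, rfl⟩
    refine ⟨⟨_, hW.1⟩, rfl, le_antisymm ?_ ?_⟩
    · refine h.rank_le_iff.2 fun V hV => ?_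
      have hVY : (V : Set (SuccOrd κ)) ∈ below μ (Y : Set (SuccOrd κ)) :=
        ⟨V.2, hV.trans hW.2⟩
      rw [hf] at hVY
      obtain ⟨V', hV', hVV'⟩ := hVY
      rw [hVV'] at hV
      have hV'Z := (imageOf_ssubset_imageOf_iff f hV'.2.subset hZX).1 hV
      obtain ⟨W, hW1, hW2⟩ := ih ⟨V', hV'.1⟩ hV'Z hV'.2.subset
      rw [Subtype.ext (hVV'.trans hW1.symm), hW2]
      exact h.rank_lt_rank hV'Z
    · refine h.rank_le_iff.2 fun V hV => ?_
      have hVX := hV.subset.trans hZX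
      obtain ⟨W, hW1, hW2⟩ := ih V hV hVX
      rw [← hW2]
      refine h.rank_lt_rank ?_
      rw [hW1]
      exact (imageOf_ssubset_imageOf_iff f hVX hZX).2 hV

/-- The alternative of local almost directedness in the form in which it is used: below `X`, either
any two members have an upper bound below `X`, or `X = X₁ * X₂` and every member below `X` is
included in `X₁` or in `X₂`. -/
theorem directed_or_star (h : IsTwoCardinal κ μ) (X : μ) :
    (∀ Y Z : μ, (Y : Set (SuccOrd κ)) ⊂ X → (Z : Set (SuccOrd κ)) ⊂ X →
      ∃ W : μ, (W : Set (SuccOrd κ)) ⊂ X ∧ (Y : Set (SuccOrd κ)) ⊆ W ∧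
        (Z : Set (SuccOrd κ)) ⊆ W) ∨
    ∃ X₁ X₂ : μ, rank h.wf X₁ = rank h.wf X₂ ∧
      IsStar (X : Set (SuccOrd κ)) X₁ X₂ ∧
      (X₁ : Set (SuccOrd κ)) ⊂ X ∧ (X₂ : Set (SuccOrd κ)) ⊂ X ∧
      ∀ Y : μ, (Y : Set (SuccOrd κ)) ⊂ X →
        (Y : Set (SuccOrd κ)) ⊆ X₁ ∨ (Y : Set (SuccOrd κ)) ⊆ X₂ := by
  rcases h.locally_almost_directed X with hd | ⟨X₁, X₂, hr, hs, hb⟩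
  · left
    intro Y Z hY hZ
    obtain ⟨W, hW, hYW, hZW⟩ := hd Y ⟨Y.2, hY⟩ Z ⟨Z.2, hZ⟩
    exact ⟨⟨W, hW.1⟩, hW.2, hYW, hZW⟩
  · right
    have h₁ : (X₁ : Set (SuccOrd κ)) ∈ below μ (X : Set (SuccOrd κ)) := by rw [hb]; simp
    have h₂ : (X₂ : Set (SuccOrd κ)) ∈ below μ (X : Set (SuccOrd κ)) := by rw [hb]; simp
    refine ⟨X₁, X₂, hr, hs, h₁.2, h₂.2, fun Y hY => ?_⟩
    have hY' : (Y : Set (SuccOrd κ)) ∈ below μ (X : Set (SuccOrd κ)) := ⟨Y.2, hY⟩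
    rw [hb] at hY'
    rcases hY' with (hY' | hY') | hY' | hY'
    · exact Or.inl hY'.2.subset
    · exact Or.inr hY'.2.subset
    · exact Or.inl hY'.subset
    · exact Or.inr hY'.subset

/-- In a decomposition `X = X₁ * X₂`, the intersection `X₁ ∩ X₂` is an initial segment of both
parts. -/
theorem star_inter_Iio_eq (h : IsTwoCardinal κ μ) {X X₁ X₂ : μ}
    (hr : rank h.wf X₁ = rank h.wf X₂) (hs : IsStar (X : Set (SuccOrd κ)) X₁ X₂)
    {α : SuccOrd κ} (h₁ : α ∈ (X₁ : Set (SuccOrd κ))) (h₂ : α ∈ (X₂ : Set (SuccOrd κ))) :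
    (X₁ : Set (SuccOrd κ)) ∩ Set.Iio α = (X₂ : Set (SuccOrd κ)) ∩ Set.Iio α := by
  obtain ⟨-, hs₁, hs₂, -⟩ := hs
  ext β
  refine ⟨fun ⟨hβ, hlt⟩ => ⟨?_, hlt⟩, fun ⟨hβ, hlt⟩ => ⟨?_, hlt⟩⟩
  · by_contra hβ₂
    exact lt_asymm hlt (hs₁ α ⟨h₁, h₂⟩ β ⟨hβ, hβ₂⟩)
  · by_contra hβ₁
    by_cases hsub : (X₁ : Set (SuccOrd κ)) ⊆ X₂
    · rw [h.eq_of_subset_of_rank_eq hsub hr] at hβ₁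
      exact hβ₁ hβ
    · obtain ⟨γ, hγ₁, hγ₂⟩ := Set.not_subset.1 hsub
      exact lt_asymm hlt ((hs₁ α ⟨h₁, h₂⟩ γ ⟨hγ₁, hγ₂⟩).trans (hs₂ γ ⟨hγ₁, hγ₂⟩ β ⟨hβ, hβ₁⟩))

/-- Coherence: two members of the same rank agree below each of their common elements. The proof
is by induction on a member that includes both; when they lie in different halves of
`Z = Z₁ * Z₂`, the one in `Z₂` is pulled back to `Z₁` along the order isomorphism, which fixes
`Z₁ ∩ Z₂`. -/
theorem inter_Iio_eq (h : IsTwoCardinal κ μ) {X Y : μ} (hr : rank h.wf X = rank h.wf Y)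
    {α : SuccOrd κ} (hX : α ∈ (X : Set (SuccOrd κ))) (hY : α ∈ (Y : Set (SuccOrd κ))) :
    (X : Set (SuccOrd κ)) ∩ Set.Iio α = (Y : Set (SuccOrd κ)) ∩ Set.Iio α := by
  suffices key : ∀ Z X Y : μ, (X : Set (SuccOrd κ)) ⊆ Z → (Y : Set (SuccOrd κ)) ⊆ Z →
      rank h.wf X = rank h.wf Y → α ∈ (X : Set (SuccOrd κ)) → α ∈ (Y : Set (SuccOrd κ)) →
      (X : Set (SuccOrd κ)) ∩ Set.Iio α = (Y : Set (SuccOrd κ)) ∩ Set.Iio α by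
    obtain ⟨Z, hZ, hXZ, hYZ⟩ := h.directed X X.2 Y Y.2
    exact key ⟨Z, hZ⟩ X Y hXZ hYZ hr hX hY
  clear hr hX hY X Y
  intro Z
  induction Z using h.wf.induction with
  | _ Z ih =>
    intro X Y hXZ hYZ hr hX hY
    rcases hXZ.eq_or_ssubset with heq | hXss
    · rw [h.eq_of_subset_of_rank_eq (hYZ.trans heq.ge) hr.symm]
    rcases hYZ.eq_or_ssubset with heq | hYss
    · rw [h.eq_of_subset_of_rank_eq (hXZ.trans heq.ge) hr]
    rcases h.directed_or_star Z with hd | ⟨Z₁, Z₂, hrZ, hs, hZ₁, hZ₂, hcov⟩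
    · obtain ⟨W, hW, hXW, hYW⟩ := hd X Y hXss hYss
      exact ih W hW X Y hXW hYW hr hX hY
    have cross : ∀ X Y : μ, (X : Set (SuccOrd κ)) ⊆ Z₁ → (Y : Set (SuccOrd κ)) ⊆ Z₂ →
        rank h.wf X = rank h.wf Y → α ∈ (X : Set (SuccOrd κ)) → α ∈ (Y : Set (SuccOrd κ)) →
        (X : Set (SuccOrd κ)) ∩ Set.Iio α = (Y : Set (SuccOrd κ)) ∩ Set.Iio α := by
      intro X Y hXZ₁ hYZ₂ hr hX hY
      obtain ⟨f, hf⟩ := h.exists_transport hrZ.symm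
      have hfix : ∀ β (h₂ : β ∈ (Z₂ : Set (SuccOrd κ))), β ∈ (Z₁ : Set (SuccOrd κ)) →
          (f ⟨β, h₂⟩ : SuccOrd κ) = β := fun β h₂ h₁ =>
        orderIso_apply_eq f h₂ h₁ (congrArg ordtp (h.star_inter_Iio_eq hrZ hs h₁ h₂).symm)
      obtain ⟨W, hWY, hrW⟩ := hf Y hYZ₂
      have hαW : α ∈ (W : Set (SuccOrd κ)) := by
        rw [hWY]; exact ⟨⟨α, hYZ₂ hY⟩, hY, hfix _ _ (hXZ₁ hX)⟩
      rw [ih Z₁ hZ₁ X W hXZ₁ (hWY ▸ imageOf_subset _ _) (hr.trans hrW.symm) hX hαW, hWY]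
      have hseg := h.star_inter_Iio_eq hrZ hs (hXZ₁ hX) (hYZ₂ hY)
      ext β
      refine ⟨fun ⟨hβ, hlt⟩ => ⟨?_, hlt⟩, fun ⟨hβ, hlt⟩ => ⟨?_, hlt⟩⟩
      · have hβ₁ : β ∈ (Z₁ : Set (SuccOrd κ)) := imageOf_subset _ _ hβ
        have hβ₂ : β ∈ (Z₂ : Set (SuccOrd κ)) := (hseg.subset ⟨hβ₁, hlt⟩).1
        rwa [← hfix β hβ₂ hβ₁, mem_imageOf_iff] at hβ
      · exact ⟨⟨β, hYZ₂ hβ⟩, hβ, hfix β _ (hseg.superset ⟨hYZ₂ hβ, hlt⟩).1⟩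
    rcases hcov X hXss with hX' | hX' <;> rcases hcov Y hYss with hY' | hY'
    · exact ih Z₁ hZ₁ X Y hX' hY' hr hX hY
    · exact cross X Y hX' hY' hr hX hY
    · exact (cross Y X hY' hX' hr.symm hY hX).symm
    · exact ih Z₂ hZ₂ X Y hX' hY' hr hX hY

/-- Every element of a member of rank at least `ξ` lies in a smaller member of rank exactly `ξ`. -/
theorem exists_subset_rank_eq (h : IsTwoCardinal κ μ) {ξ : Ordinal.{u}} {α : SuccOrd κ} (X : μ)
    (hX : α ∈ (X : Set (SuccOrd κ))) (hξ : ξ ≤ rank h.wf X) :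
    ∃ Y : μ, (Y : Set (SuccOrd κ)) ⊆ X ∧ α ∈ (Y : Set (SuccOrd κ)) ∧ rank h.wf Y = ξ := by
  induction X using h.wf.induction with
  | _ X ih =>
    rcases hξ.eq_or_lt with heq | hlt
    · exact ⟨X, subset_rfl, hX, heq.symm⟩
    -- It suffices to find a member strictly below `X` of rank at least `ξ` that contains `α`.
    suffices hsmall : ∃ W : μ, (W : Set (SuccOrd κ)) ⊂ X ∧ α ∈ (W : Set (SuccOrd κ)) ∧
        ξ ≤ rank h.wf W by
      obtain ⟨W, hW, hαW, hξW⟩ := hsmall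
      obtain ⟨Y, hYW, hαY, hY⟩ := ih W hW hαW hξW
      exact ⟨Y, hYW.trans hW.subset, hαY, hY⟩
    have hα := hX
    rw [h.neat X (pos_of_gt hlt).ne'] at hα
    obtain ⟨V, hV, hαV⟩ := hα
    obtain ⟨U, hU, hξU⟩ : ∃ U : μ, (U : Set (SuccOrd κ)) ⊂ X ∧ ξ ≤ rank h.wf U := by
      by_contra! hcon
      exact hlt.not_ge (h.rank_le_iff.2 hcon)
    rcases h.directed_or_star X with hd | ⟨X₁, X₂, hr, -, hX₁, hX₂, hcov⟩
    · obtain ⟨W, hW, hUW, hVW⟩ := hd U ⟨V, hV.1⟩ hU hV.2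
      exact ⟨W, hW, hVW hαV, hξU.trans (h.rank_mono hUW)⟩
    · have hξ₁ : ξ ≤ rank h.wf X₁ := by
        rcases hcov U hU with hU' | hU'
        · exact hξU.trans (h.rank_mono hU')
        · exact hξU.trans ((h.rank_mono hU').trans hr.ge)
      rcases hcov ⟨V, hV.1⟩ hV.2 with hV' | hV'
      · exact ⟨X₁, hX₁, hV' hαV, hξ₁⟩
      · exact ⟨X₂, hX₂, hV' hαV, hξ₁.trans hr.le⟩

/-! ### The functions `f_α` -/

theorem kurepaFun_eq (h : IsTwoCardinal κ μ) (X : μ) {α : SuccOrd κ}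
    (hX : α ∈ (X : Set (SuccOrd κ))) :
    kurepaFun h α (rank h.wf X) = ordtp ((X : Set (SuccOrd κ)) ∩ Set.Iio α) := by
  refine congrArg ordtp (Set.Subset.antisymm ?_ fun β hβ => ⟨X, rfl, hX, hβ⟩)
  rintro β ⟨Y, hr, hY, hβ⟩
  rwa [h.inter_Iio_eq hr hY hX] at hβ

/-- Members of rank `ξ` that contain `α` and `β` at the same place make `f_α` and `f_β` agree up
to `ξ`. -/
theorem kurepaFun_eq_of_le (h : IsTwoCardinal κ μ) {X Y : μ} (hr : rank h.wf X = rank h.wf Y)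
    {α β : SuccOrd κ} (hα : α ∈ (X : Set (SuccOrd κ))) (hβ : β ∈ (Y : Set (SuccOrd κ)))
    (heq : ordtp ((X : Set (SuccOrd κ)) ∩ Set.Iio α) = ordtp ((Y : Set (SuccOrd κ)) ∩ Set.Iio β))
    {η : Ordinal.{u}} (hη : η ≤ rank h.wf X) : kurepaFun h α η = kurepaFun h β η := by
  obtain ⟨f, hf⟩ := h.exists_transport hr
  have hfα : (f ⟨α, hα⟩ : SuccOrd κ) = β := orderIso_apply_eq f hα hβ heq
  obtain ⟨Z, hZX, hαZ, rfl⟩ := h.exists_subset_rank_eq X hα hη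
  obtain ⟨W, hWZ, hrW⟩ := hf Z hZX
  have hβW : β ∈ (W : Set (SuccOrd κ)) := by
    rw [hWZ, ← hfα, mem_imageOf_iff]; exact hαZ
  rw [h.kurepaFun_eq Z hαZ, ← hrW, h.kurepaFun_eq W hβW, hWZ, ← hfα,
    ordtp_imageOf_inter_Iio f hZX]

/-- A member of rank `ξ` that contains `α` and `β` makes `f_α` and `f_β` differ at `ξ`. -/
theorem kurepaFun_rank_injOn (h : IsTwoCardinal κ μ) (X : μ) {α β : SuccOrd κ}
    (hα : α ∈ (X : Set (SuccOrd κ))) (hβ : β ∈ (X : Set (SuccOrd κ)))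
    (heq : kurepaFun h α (rank h.wf X) = kurepaFun h β (rank h.wf X)) : α = β := by
  rw [h.kurepaFun_eq X hα, h.kurepaFun_eq X hβ] at heq
  exact eq_of_ordtp_inter_Iio_eq hα hβ heq

/-- If `β` lies in some member of rank at least that of `X`, then `f_β` agrees up to the rank of `X`
with some `f_α`, `α ∈ X`. -/
theorem exists_mem_kurepaFun_eq (h : IsTwoCardinal κ μ) (X : μ) {β : SuccOrd κ}
    (hβ : ∃ Y : μ, β ∈ (Y : Set (SuccOrd κ)) ∧ rank h.wf X ≤ rank h.wf Y) :
    ∃ α ∈ (X : Set (SuccOrd κ)), ∀ η ≤ rank h.wf X, kurepaFun h β η = kurepaFun h α η := by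
  obtain ⟨Y', hβY', hle⟩ := hβ
  obtain ⟨Y, -, hβY, hr⟩ := h.exists_subset_rank_eq Y' hβY' hle
  obtain ⟨f, -⟩ := h.exists_transport hr
  exact ⟨f ⟨β, hβY⟩, (f _).2, fun η hη => h.kurepaFun_eq_of_le hr hβY (f _).2
    (ordtp_inter_Iio_apply f ⟨β, hβY⟩).symm (hη.trans hr.ge)⟩

end IsTwoCardinal

/-! ### Stationarity -/

section SmallSets

variable {κ : Cardinal.{u}}

theorem exists_notMem_of_mem_smallSubsets {X : Set (SuccOrd κ)}
    (hX : X ∈ smallSubsets κ (SuccOrd κ)) : ∃ a, a ∉ X := by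
  by_contra! hall
  have hX' : #X < κ := hX
  rw [Set.eq_univ_of_forall hall, mk_univ, mk_ord_toType] at hX'
  exact hX'.not_ge (Order.le_succ κ)

theorem union_mem_smallSubsets {A : Type u} (hκ : ℵ₀ ≤ κ) {X Y : Set A}
    (hX : X ∈ smallSubsets κ A) (hY : Y ∈ smallSubsets κ A) : X ∪ Y ∈ smallSubsets κ A :=
  (mk_union_le X Y).trans_lt (add_lt_of_lt hκ hX hY)

theorem singleton_mem_smallSubsets {A : Type u} (hκ : ℵ₀ ≤ κ) (a : A) :
    {a} ∈ smallSubsets κ A := by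
  change #({a} : Set A) < κ
  rw [mk_singleton]
  exact one_lt_aleph0.trans_le hκ

theorem insert_mem_smallSubsets {A : Type u} (hκ : ℵ₀ ≤ κ) (a : A) {X : Set A}
    (hX : X ∈ smallSubsets κ A) : insert a X ∈ smallSubsets κ A :=
  union_mem_smallSubsets hκ (singleton_mem_smallSubsets hκ a) hX

theorem sUnion_mem_smallSubsets {A : Type u} (hκ : κ.IsRegular) {c : Set (Set A)}
    (hc : c ⊆ smallSubsets κ A) (hcard : #c < κ) : ⋃₀ c ∈ smallSubsets κ A := by
  change #(⋃₀ c) < κ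
  rw [Set.sUnion_eq_iUnion, card_iUnion_lt_iff_forall_of_isRegular hκ hcard]
  exact fun X => hc X.2

theorem isClubFamily_superset {A : Type u} (hκ : κ.IsRegular) {X : Set A}
    (hX : X ∈ smallSubsets κ A) : IsClubFamily κ {Y | Y ∈ smallSubsets κ A ∧ X ⊆ Y} where
  subset := fun _ hY => hY.1
  unbounded := fun Y hY => ⟨Y ∪ X, ⟨union_mem_smallSubsets hκ.aleph0_le hY hX,
    Set.subset_union_right⟩, Set.subset_union_left⟩
  closed := by
    rintro c hc ⟨Y, hY⟩ - hcard
    exact ⟨sUnion_mem_smallSubsets hκ (fun Y hY => (hc hY).1) hcard,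
      (hc hY).2.trans (Set.subset_sUnion_of_mem hY)⟩

/-- For uncountable regular `κ`, the small sets closed under a set-valued map form a club; a given
small set is closed off in `ω` steps. -/
theorem isClubFamily_closed {A : Type u} (hκ : κ.IsRegular) (hκ' : ℵ₀ < κ) (G : A → Set A)
    (hG : ∀ a, G a ∈ smallSubsets κ A) :
    IsClubFamily κ {Y | Y ∈ smallSubsets κ A ∧ ∀ a ∈ Y, G a ⊆ Y} where
  subset := fun _ hY => hY.1
  unbounded := by
    intro X hX
    let F : ℕ → Set A := fun n => n.rec X fun _ Y => Y ∪ ⋃ a ∈ Y, G a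
    have hF : ∀ n, F n ∈ smallSubsets κ A := by
      intro n
      induction n with
      | zero => exact hX
      | succ n ih =>
        exact union_mem_smallSubsets hκ.aleph0_le ih
          ((card_biUnion_lt_iff_forall_of_isRegular hκ ih).2 fun a _ => hG a)
    refine ⟨⋃₀ Set.range F, ⟨sUnion_mem_smallSubsets hκ ?_ ?_, ?_⟩,
      Set.subset_sUnion_of_mem ⟨0, rfl⟩⟩
    · rintro _ ⟨n, rfl⟩
      exact hF n
    · exact (Set.countable_range F).le_aleph0.trans_lt hκ'
    · rintro a ⟨_, ⟨n, rfl⟩, ha⟩ b hb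
      exact ⟨F (n + 1), ⟨n + 1, rfl⟩, Or.inr (Set.mem_biUnion ha hb)⟩
  closed := by
    rintro c hc - - hcard
    refine ⟨sUnion_mem_smallSubsets hκ (fun Y hY => (hc hY).1) hcard, ?_⟩
    rintro a ⟨Y, hY, ha⟩
    exact ((hc hY).2 a ha).trans (Set.subset_sUnion_of_mem hY)

/-- For `κ = ω` only finite chains have to be closed off, so every cofinal family is a club. -/
theorem isClubFamily_aleph0_of_unbounded {A : Type u} {C : Set (Set A)}
    (hsub : C ⊆ smallSubsets ℵ₀ A) (hunb : ∀ X ∈ smallSubsets ℵ₀ A, ∃ Y ∈ C, X ⊆ Y) :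
    IsClubFamily ℵ₀ C where
  subset := hsub
  unbounded := hunb
  closed := by
    intro c hc hne hchain hcard
    obtain ⟨m, hm⟩ := (lt_aleph0_iff_set_finite.1 hcard).exists_maximal hne
    have hunion : ⋃₀ c = m := by
      refine (Set.sUnion_subset fun Y hY => ?_).antisymm (Set.subset_sUnion_of_mem hm.1)
      rcases hchain.total hY hm.1 with h | h
      · exact h
      · exact hm.2 hY h
    rw [hunion]
    exact hc hm.1

end SmallSets

namespace IsStationaryTwoCardinal

variable {κ : Cardinal.{u}} {μ : Set (Set (SuccOrd κ))}

theorem exists_superset (hκ : κ.IsRegular) (h : IsStationaryTwoCardinal κ μ)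
    {X : Set (SuccOrd κ)} (hX : X ∈ smallSubsets κ (SuccOrd κ)) :
    ∃ Y : μ, X ⊆ (Y : Set (SuccOrd κ)) := by
  obtain ⟨Y, hY, -, hXY⟩ := h.stationary.2 _ (isClubFamily_superset hκ hX)
  exact ⟨⟨Y, hY⟩, hXY⟩

/-- There is no stationary `(ω, ω₁)`-cardinal: it would contain all finite supersets of some
finite `X`, but for distinct `a`, `b`, `c` outside `X` the member `X ∪ {a, b, c}` has three maximal
proper subsets `X ∪ {a, b}`, `X ∪ {a, c}`, `X ∪ {b, c}`, while local almost directedness leaves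
room for two at most. -/
theorem ne_aleph0 (h : IsStationaryTwoCardinal κ μ) : κ ≠ ℵ₀ := by
  rintro rfl
  obtain ⟨X, hX, hXμ⟩ : ∃ X ∈ smallSubsets ℵ₀ (SuccOrd ℵ₀),
      ∀ Y ∈ smallSubsets ℵ₀ (SuccOrd ℵ₀), X ⊆ Y → Y ∈ μ := by
    by_contra! hcon
    obtain ⟨Y, hY, -, hY'⟩ := h.stationary.2 {Y | Y ∈ smallSubsets ℵ₀ (SuccOrd ℵ₀) ∧ Y ∉ μ}
      (isClubFamily_aleph0_of_unbounded (fun _ hY => hY.1) fun X hX => by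
        obtain ⟨Y, hY, hXY, hYμ⟩ := hcon X hX
        exact ⟨Y, ⟨hY, hYμ⟩, hXY⟩)
    exact hY' hY
  have hins : ∀ (a : SuccOrd ℵ₀) {Y : Set (SuccOrd ℵ₀)}, Y ∈ smallSubsets ℵ₀ (SuccOrd ℵ₀) →
      insert a Y ∈ smallSubsets ℵ₀ (SuccOrd ℵ₀) :=
    fun a _ hY => insert_mem_smallSubsets le_rfl a hY
  obtain ⟨a, ha⟩ := exists_notMem_of_mem_smallSubsets hX
  obtain ⟨b, hb⟩ := exists_notMem_of_mem_smallSubsets (hins a hX)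
  obtain ⟨c, hc⟩ := exists_notMem_of_mem_smallSubsets (hins b (hins a hX))
  simp only [Set.mem_insert_iff, not_or] at hb hc
  have hmem : ∀ x y, insert x (insert y X) ∈ μ := fun x y =>
    hXμ _ (hins x (hins y hX)) fun z hz => Or.inr (Or.inr hz)
  let Z : μ := ⟨insert a (insert b (insert c X)),
    hXμ _ (hins a (hins b (hins c hX))) fun z hz => Or.inr (Or.inr (Or.inr hz))⟩
  have hZ : (Z : Set (SuccOrd ℵ₀)) = insert a (insert b (insert c X)) := rfl
  have hab : insert a (insert b X) ⊂ (Z : Set (SuccOrd ℵ₀)) := by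
    refine ⟨fun z hz => ?_, fun hsub => ?_⟩
    · simp only [hZ, Set.mem_insert_iff] at hz ⊢; tauto
    · have := hsub (show c ∈ (Z : Set (SuccOrd ℵ₀)) by simp [hZ])
      simp only [Set.mem_insert_iff] at this; tauto
  have hac : insert a (insert c X) ⊂ (Z : Set (SuccOrd ℵ₀)) := by
    refine ⟨fun z hz => ?_, fun hsub => ?_⟩
    · simp only [hZ, Set.mem_insert_iff] at hz ⊢; tauto
    · have := hsub (show b ∈ (Z : Set (SuccOrd ℵ₀)) by simp [hZ])
      simp only [Set.mem_insert_iff, eq_comm (a := b)] at this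
      have hbc := hc.1
      have hba := hb.1
      simp only [eq_comm (a := b)] at hba
      tauto
  have hbc : insert b (insert c X) ⊂ (Z : Set (SuccOrd ℵ₀)) := by
    refine ⟨fun z hz => ?_, fun hsub => ?_⟩
    · simp only [hZ, Set.mem_insert_iff] at hz ⊢; tauto
    · have := hsub (show a ∈ (Z : Set (SuccOrd ℵ₀)) by simp [hZ])
      simp only [Set.mem_insert_iff, eq_comm (a := a)] at this
      tauto
  -- A set that includes two of the three subsets includes `Z`.
  have h₁ : ∀ W : Set (SuccOrd ℵ₀), insert a (insert b X) ⊆ W → insert a (insert c X) ⊆ W →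
      ¬ W ⊂ Z := by
    intro W hW₁ hW₂ hW
    refine hW.2 fun z hz => ?_
    rcases hz with rfl | rfl | hz
    exacts [hW₁ (by simp), hW₁ (by simp), hW₂ (Or.inr hz)]
  have h₂ : ∀ W : Set (SuccOrd ℵ₀), insert a (insert b X) ⊆ W → insert b (insert c X) ⊆ W →
      ¬ W ⊂ Z := by
    intro W hW₁ hW₂ hW
    refine hW.2 fun z hz => ?_
    rcases hz with rfl | rfl | hz
    exacts [hW₁ (by simp), hW₁ (by simp), hW₂ (Or.inr hz)]
  have h₃ : ∀ W : Set (SuccOrd ℵ₀), insert a (insert c X) ⊆ W → insert b (insert c X) ⊆ W →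
      ¬ W ⊂ Z := by
    intro W hW₁ hW₂ hW
    refine hW.2 fun z hz => ?_
    rcases hz with rfl | rfl | hz
    exacts [hW₁ (by simp), hW₂ (by simp), hW₂ (Or.inr hz)]
  rcases h.directed_or_star Z with hd | ⟨X₁, X₂, -, -, hX₁, hX₂, hcov⟩
  · obtain ⟨W, hW, hW₁, hW₂⟩ := hd ⟨_, hmem a b⟩ ⟨_, hmem a c⟩ hab hac
    exact h₁ W hW₁ hW₂ hW
  · rcases hcov ⟨_, hmem a b⟩ hab with p | p <;> rcases hcov ⟨_, hmem a c⟩ hac with q | q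
    · exact h₁ _ p q hX₁
    · rcases hcov ⟨_, hmem b c⟩ hbc with r | r
      · exact h₂ _ p r hX₁
      · exact h₃ _ q r hX₂
    · rcases hcov ⟨_, hmem b c⟩ hbc with r | r
      · exact h₃ _ q r hX₁
      · exact h₂ _ p r hX₂
    · exact h₁ _ p q hX₂

theorem exists_rank_ge (hκ : κ.IsRegular) (h : IsStationaryTwoCardinal κ μ) {ξ : Ordinal.{u}}
    (hξ : ξ < κ.ord) : ∃ X : μ, ξ ≤ rank h.wf X := by
  induction ξ using WellFoundedLT.induction with
  | _ ξ ih =>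
    choose X hX using fun i : ξ.ToType => ih i.toOrd i.toOrd.2 (i.toOrd.2.trans hξ)
    have hU : (⋃ i, (X i : Set (SuccOrd κ))) ∈ smallSubsets κ (SuccOrd κ) :=
      (card_iUnion_lt_iff_forall_of_isRegular hκ (by rw [mk_toType]; exact lt_ord.1 hξ)).2
        fun i => h.small (X i).2
    -- The extra point makes the inclusions below strict, which takes care of successor `ξ`.
    obtain ⟨a, ha⟩ := exists_notMem_of_mem_smallSubsets hU
    obtain ⟨Y, hY⟩ := h.exists_superset hκ (insert_mem_smallSubsets hκ.aleph0_le a hU)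
    refine ⟨Y, le_of_forall_lt fun η hη => ?_⟩
    have hXY : (X (ToType.mk ⟨η, hη⟩) : Set (SuccOrd κ)) ⊂ Y := by
      refine ⟨((Set.subset_iUnion (fun i => (X i : Set (SuccOrd κ))) _).trans
        (Set.subset_insert _ _)).trans hY, fun hsub => ha ?_⟩
      exact Set.mem_iUnion.2 ⟨_, hsub (hY (Set.mem_insert a _))⟩
    refine lt_of_le_of_lt ?_ (h.rank_lt_rank hXY)
    simpa using hX (ToType.mk ⟨η, hη⟩)

theorem exists_mem_rank_ge (hκ : κ.IsRegular) (h : IsStationaryTwoCardinal κ μ)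
    (α : SuccOrd κ) {ξ : Ordinal.{u}} (hξ : ξ < κ.ord) :
    ∃ X : μ, α ∈ (X : Set (SuccOrd κ)) ∧ ξ ≤ rank h.wf X := by
  obtain ⟨X, hX⟩ := h.exists_rank_ge hκ hξ
  obtain ⟨Y, hY⟩ := h.exists_superset hκ
    (insert_mem_smallSubsets hκ.aleph0_le α (h.small X.2))
  exact ⟨Y, hY (Set.mem_insert _ _), hX.trans (h.rank_mono ((Set.subset_insert _ _).trans hY))⟩

/-- The form in which stationarity enters: some member `X` has rank at least `φ α` for all of its
elements `α`. For each `α` choose a member `Y α` of rank at least `φ α`; a member `X` that includes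
`Y α` for all `α ∈ X` will do, and the small sets with this closure property form a club. -/
theorem exists_forall_mem_le_rank (hκ : κ.IsRegular) (h : IsStationaryTwoCardinal κ μ)
    (φ : SuccOrd κ → Ordinal.{u}) (hφ : ∀ α, φ α < κ.ord) :
    ∃ X : μ, ∀ α ∈ (X : Set (SuccOrd κ)), φ α ≤ rank h.wf X := by
  choose Y hY using fun α => h.exists_rank_ge hκ (hφ α)
  obtain ⟨X, hX, -, hcl⟩ := h.stationary.2 _ (isClubFamily_closed hκ
    (hκ.aleph0_le.lt_of_ne' h.ne_aleph0) (fun α => (Y α : Set (SuccOrd κ)))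
    fun α => h.small (Y α).2)
  exact ⟨⟨X, hX⟩, fun α hα => (hY α).trans (h.rank_mono (Y := ⟨X, hX⟩) (hcl α hα))⟩

end IsStationaryTwoCardinal

/-! ### Levels and branches of trees -/

theorem le_of_strictMono_Iio {ξ ζ : Ordinal.{u}} {f : Set.Iio ξ → Ordinal.{u}}
    (hf : StrictMono f) (hζ : ∀ x, f x < ζ) : ξ ≤ ζ := by
  have hle : ∀ η (hη : η < ξ), η ≤ f ⟨η, hη⟩ := by
    intro η
    induction η using WellFoundedLT.induction with
    | _ η ih =>
      intro hη
      refine le_of_forall_lt fun θ hθ => ?_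
      exact (ih θ hθ (hθ.trans hη)).trans_lt
        (hf (show (⟨θ, hθ.trans hη⟩ : Set.Iio ξ) < ⟨η, hη⟩ from hθ))
  by_contra! hlt
  exact (hle ζ hlt).not_gt (hζ _)

theorem eq_of_orderIso_Iio {ξ ζ : Ordinal.{u}} (e : Set.Iio ξ ≃o Set.Iio ζ) : ξ = ζ :=
  le_antisymm (le_of_strictMono_Iio (f := fun x => (e x : Ordinal)) (fun _ _ h => e.lt_iff_lt.2 h)
      fun x => (e x).2)
    (le_of_strictMono_Iio (f := fun x => (e.symm x : Ordinal)) (fun _ _ h => e.symm.lt_iff_lt.2 h)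
      fun x => (e.symm x).2)

section Trees

variable {P : Type v} [PartialOrder P] {T : Set P}

theorem eq_of_mem_level {t : P} {ξ ζ : Ordinal.{u}} (hξ : t ∈ level T ξ) (hζ : t ∈ level T ζ) :
    ξ = ζ := by
  obtain ⟨-, ⟨e⟩⟩ := hξ
  obtain ⟨-, ⟨e'⟩⟩ := hζ
  exact eq_of_orderIso_Iio (e.symm.trans e')

/-- An order isomorphism of a set with an initial segment of the ordinals locates the levels of its
elements. -/
theorem mem_level_of_orderIso {S : Set P} (hS : S ⊆ T) (hclosed : ∀ s ∈ S, ∀ r ∈ T, r < s → r ∈ S)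
    {δ : Ordinal.{u}} (e : S ≃o Set.Iio δ) (s : S) : (s : P) ∈ level T (e s : Ordinal.{u}) := by
  refine ⟨hS s.2, ⟨?_⟩⟩
  exact
    { toFun := fun r => ⟨e ⟨r, hclosed s s.2 r r.2.1 r.2.2⟩, e.lt_iff_lt.2 r.2.2⟩
      invFun := fun η => ⟨e.symm ⟨η, lt_trans (Set.mem_Iio.1 η.2) (Set.mem_Iio.1 (e s).2)⟩, hS (e.symm _).2, by
        have : e.symm ⟨η, lt_trans (Set.mem_Iio.1 η.2) (Set.mem_Iio.1 (e s).2)⟩ < s := by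
          rw [← e.lt_iff_lt, e.apply_symm_apply]
          exact η.2
        exact this⟩
      left_inv := fun r => by
        have hr := congrArg Subtype.val (e.symm_apply_apply ⟨r, hclosed s s.2 r r.2.1 r.2.2⟩)
        exact Subtype.ext hr
      right_inv := fun η => by simp
      map_rel_iff' := e.map_rel_iff }

theorem exists_lt_mem_level {t : P} {ξ δ : Ordinal.{u}} (ht : t ∈ level T δ) (hξ : ξ < δ) :
    ∃ s ∈ level T ξ, s < t := by
  obtain ⟨-, ⟨e⟩⟩ := ht
  refine ⟨e.symm ⟨ξ, hξ⟩, ?_, (e.symm ⟨ξ, hξ⟩).2.2⟩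
  have := mem_level_of_orderIso (S := {s | s ∈ T ∧ s < t}) (fun s hs => hs.1)
    (fun s hs r hr hrs => ⟨hr, hrs.trans hs.2⟩) e (e.symm ⟨ξ, hξ⟩)
  rwa [e.apply_symm_apply] at this

/-- A branch of length `κ`, taken by itself, is a `κ`-tree with one element on each level. -/
theorem IsBranch.isKappaTree {κ : Cardinal.{u}} (hκ : 1 < κ) {b : Set P}
    (hb : IsBranch κ T b) : IsKappaTree κ b := by
  obtain ⟨e⟩ := hb.length
  have hlev : ∀ s : b, (s : P) ∈ level b (e s : Ordinal.{u}) :=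
    mem_level_of_orderIso subset_rfl (fun _ _ _ hr _ => hr) e
  refine ⟨fun t _ => ⟨hb.chain.mono fun s hs => hs.1, ?_⟩, fun t ht => ⟨_, (e ⟨t, ht⟩).2,
    hlev ⟨t, ht⟩⟩, fun ξ hξ => ⟨e.symm ⟨ξ, hξ⟩, ?_⟩, fun ξ _ => ?_⟩
  · have hwf : b.IsWF := by
      exact e.toRelIsoLT.toRelEmbedding.wellFounded wellFounded_lt
    exact hwf.mono fun s hs => hs.1
  · have := hlev (e.symm ⟨ξ, hξ⟩)
    rwa [e.apply_symm_apply] at this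
  · have hsub : (level b ξ).Subsingleton := by
      intro s hs t ht
      have h1 := eq_of_mem_level hs (hlev ⟨s, hs.1⟩)
      have h2 := eq_of_mem_level ht (hlev ⟨t, ht.1⟩)
      exact congrArg Subtype.val (e.injective (Subtype.ext (h1.symm.trans h2)))
    refine lt_of_le_of_lt ?_ (lift_lt.2 hκ)
    rw [Cardinal.lift_one, lift_le_one_iff]
    exact mk_le_one_iff_set_subsingleton.2 hsub

end Trees

/-- A cofinal subset of a regular cardinal is isomorphic to that cardinal. -/
theorem nonempty_orderIso_of_unbounded {κ : Cardinal.{u}} (hκ : κ.IsRegular)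
    {S : Set (Set.Iio κ.ord)} (hS : IsCofinal S) : Nonempty (Set.Iio κ.ord ≃o S) := by
  have : IsRegularCardinalOrder (Set.Iio κ.ord) := ⟨by
    rw [cof_Iio, type_Iio_lt, typein_ordinal, ← lift_cof, hκ.cof_ord, lift_ord]⟩
  exact ⟨Order.enum S hS⟩

/-! ### Restrictions -/

section Restrictions

variable {f g : Ordinal.{u} → Ordinal.{u}} {ξ ζ : Ordinal.{u}}

theorem restr_subset_restr_iff : restr f ξ ⊆ restr g ζ ↔ ξ ≤ ζ ∧ ∀ η < ξ, f η = g η := by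
  constructor
  · intro h
    have h' : ∀ η < ξ, η < ζ ∧ f η = g η := fun η hη => h (show (η, f η) ∈ restr f ξ from ⟨hη, rfl⟩)
    exact ⟨le_of_forall_lt fun η hη => (h' η hη).1, fun η hη => (h' η hη).2⟩
  · rintro ⟨hle, heq⟩ ⟨η, y⟩ ⟨hη, hy⟩
    exact ⟨hη.trans_le hle, hy.trans (heq η hη)⟩

theorem restr_congr (h : ∀ η < ξ, f η = g η) : restr f ξ = restr g ξ :=
  (restr_subset_restr_iff.2 ⟨le_rfl, h⟩).antisymm
    (restr_subset_restr_iff.2 ⟨le_rfl, fun η hη => (h η hη).symm⟩)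

theorem restr_lt_restr_iff : restr f ξ < restr g ζ ↔ ξ < ζ ∧ ∀ η < ξ, f η = g η := by
  constructor
  · intro h
    obtain ⟨hle, heq⟩ := restr_subset_restr_iff.1 h.le
    refine ⟨hle.lt_of_ne ?_, heq⟩
    rintro rfl
    exact h.ne (restr_congr heq)
  · rintro ⟨hlt, heq⟩
    refine lt_of_le_not_ge (restr_subset_restr_iff.2 ⟨hlt.le, heq⟩) fun hge => ?_
    exact (restr_subset_restr_iff.1 hge).1.not_gt hlt

/-- The length (domain) of a function from an ordinal, given as a set of pairs. -/
noncomputable def len (t : Set (Ordinal.{u} × Ordinal.{u})) : Ordinal.{u} :=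
  sInf {ξ | ∀ p ∈ t, p.1 < ξ}

@[simp]
theorem len_restr (f : Ordinal.{u} → Ordinal.{u}) (ξ : Ordinal.{u}) : len (restr f ξ) = ξ := by
  have hset : {ζ | ∀ p ∈ restr f ξ, p.1 < ζ} = Set.Ici ξ := by
    ext ζ
    refine ⟨fun h => le_of_forall_lt fun η hη => h (η, f η) ⟨hη, rfl⟩, fun h p hp => ?_⟩
    exact lt_of_lt_of_le hp.1 h
  rw [len, hset, csInf_Ici]

end Restrictions

namespace IsTwoCardinal

variable {κ : Cardinal.{u}} {μ : Set (Set (SuccOrd κ))}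

/-! ### The tree and its cofinal branches -/

theorem eq_restr_len (h : IsTwoCardinal κ μ) {t : Set (Ordinal.{u} × Ordinal.{u})}
    (ht : t ∈ kurepaTree h) :
    len t < κ.ord ∧ ∃ α, t = restr (kurepaFun h α) (len t) := by
  obtain ⟨α, ξ, hξ, rfl⟩ := ht
  rw [len_restr]
  exact ⟨hξ, α, rfl⟩

theorem len_lt_len (h : IsTwoCardinal κ μ) {s t : Set (Ordinal.{u} × Ordinal.{u})}
    (hs : s ∈ kurepaTree h) (ht : t ∈ kurepaTree h) (hst : s < t) : len s < len t := by
  obtain ⟨α, ξ, -, rfl⟩ := hs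
  obtain ⟨β, ζ, -, rfl⟩ := ht
  simpa using (restr_lt_restr_iff.1 hst).1

theorem eq_restr_of_lt (h : IsTwoCardinal κ μ) {s : Set (Ordinal.{u} × Ordinal.{u})}
    (hs : s ∈ kurepaTree h) {f : Ordinal.{u} → Ordinal.{u}} {ζ : Ordinal.{u}}
    (hst : s < restr f ζ) : s = restr f (len s) := by
  obtain ⟨α, ξ, -, rfl⟩ := hs
  rw [len_restr]
  exact restr_congr (restr_lt_restr_iff.1 hst).2

/-- The set of the restrictions of `f_α` to ordinals below `κ`. -/
def path (h : IsTwoCardinal κ μ) (α : SuccOrd κ) : Set (Set (Ordinal.{u} × Ordinal.{u})) :=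
  {t | ∃ ξ < κ.ord, t = restr (kurepaFun h α) ξ}

theorem path_subset (h : IsTwoCardinal κ μ) (α : SuccOrd κ) : path h α ⊆ kurepaTree h := by
  rintro _ ⟨ξ, hξ, rfl⟩
  exact ⟨α, ξ, hξ, rfl⟩

theorem path_isChain (h : IsTwoCardinal κ μ) (α : SuccOrd κ) : IsChain (· ≤ ·) (path h α) := by
  rintro _ ⟨ξ, -, rfl⟩ _ ⟨ζ, -, rfl⟩ -
  exact (le_total ξ ζ).imp (fun hle => restr_subset_restr_iff.2 ⟨hle, fun _ _ => rfl⟩)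
    (fun hle => restr_subset_restr_iff.2 ⟨hle, fun _ _ => rfl⟩)

theorem mem_level_kurepaTree (h : IsTwoCardinal κ μ) (α : SuccOrd κ) {ξ : Ordinal.{u}}
    (hξ : ξ < κ.ord) : restr (kurepaFun h α) ξ ∈ level (kurepaTree h) ξ := by
  refine ⟨⟨α, ξ, hξ, rfl⟩, ⟨(StrictMono.orderIsoOfSurjective (fun η : Set.Iio ξ =>
    (⟨restr (kurepaFun h α) η, ⟨α, η, lt_trans η.2 hξ, rfl⟩,
      restr_lt_restr_iff.2 ⟨η.2, fun _ _ => rfl⟩⟩ :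
      {s | s ∈ kurepaTree h ∧ s < restr (kurepaFun h α) ξ})) ?_ ?_).symm⟩⟩
  · exact fun η θ hlt => restr_lt_restr_iff.2 ⟨hlt, fun _ _ => rfl⟩
  · rintro ⟨s, hs, hlt⟩
    exact ⟨⟨len s, by simpa using h.len_lt_len hs ⟨α, ξ, hξ, rfl⟩ hlt⟩,
      Subtype.ext (h.eq_restr_of_lt hs hlt).symm⟩

theorem isTree_of_subset (h : IsTwoCardinal κ μ) {A : Set (Set (Ordinal.{u} × Ordinal.{u}))}
    (hA : A ⊆ kurepaTree h) : IsTree A := by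
  intro t ht
  obtain ⟨α, ξ, hξ, rfl⟩ := hA ht
  have hsub : {s | s ∈ A ∧ s < restr (kurepaFun h α) ξ} ⊆
      restr (kurepaFun h α) '' Set.univ := fun s hs =>
    ⟨len s, trivial, (h.eq_restr_of_lt (hA hs.1) hs.2).symm⟩
  have hmono : Monotone (restr (kurepaFun h α)) := fun η θ hle =>
    restr_subset_restr_iff.2 ⟨hle, fun _ _ => rfl⟩
  refine ⟨?_, ?_⟩
  · refine IsChain.mono hsub ?_
    rintro _ ⟨η, -, rfl⟩ _ ⟨θ, -, rfl⟩ -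
    exact (le_total η θ).imp (fun hle => hmono hle) (fun hle => hmono hle)
  · exact ((Set.IsWF.of_wellFoundedLT Set.univ).isPWO.image_of_monotone hmono).isWF.mono hsub

/-- If unboundedly many restrictions of `f_α` lie in `A`, then they form a branch of `A`. -/
theorem isBranch_path_inter (hκ : κ.IsRegular) (h : IsTwoCardinal κ μ) {α : SuccOrd κ}
    {A : Set (Set (Ordinal.{u} × Ordinal.{u}))} (hA : A ⊆ kurepaTree h)
    (hunb : ∀ ξ < κ.ord, ∃ ζ < κ.ord, ξ ≤ ζ ∧ restr (kurepaFun h α) ζ ∈ A) :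
    IsBranch κ A (path h α ∩ A) where
  subset := Set.inter_subset_right
  chain := (h.path_isChain α).mono Set.inter_subset_left
  maximal := by
    intro c hcA hc hsub
    refine Set.Subset.antisymm (fun t ht => ⟨?_, hcA ht⟩) hsub
    obtain ⟨β, ξ, hξ, rfl⟩ := hA (hcA ht)
    obtain ⟨ζ, hζ, hξζ, hζA⟩ := hunb ξ hξ
    refine ⟨ξ, hξ, restr_congr ?_⟩
    rcases hc.total ht (hsub ⟨⟨ζ, hζ, rfl⟩, hζA⟩) with hle | hle
    · exact (restr_subset_restr_iff.1 hle).2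
    · exact fun η hη => ((restr_subset_restr_iff.1 hle).2 η (hη.trans_le hξζ)).symm
  length := by
    let S : Set (Set.Iio κ.ord) := {ξ | restr (kurepaFun h α) ξ ∈ A}
    obtain ⟨e⟩ := nonempty_orderIso_of_unbounded hκ (S := S) fun ξ => by
      obtain ⟨ζ, hζ, hξζ, hζA⟩ := hunb ξ ξ.2
      exact ⟨⟨ζ, hζ⟩, hζA, hξζ⟩
    let e' : S ≃o (path h α ∩ A : Set (Set (Ordinal.{u} × Ordinal.{u}))) :=
      StrictMono.orderIsoOfSurjective
        (fun ξ : S => ⟨restr (kurepaFun h α) ξ.1, ⟨ξ.1, ξ.1.2, rfl⟩, ξ.2⟩)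
        (fun ξ ζ hlt => restr_lt_restr_iff.2 ⟨hlt, fun _ _ => rfl⟩) (by
          rintro ⟨_, ⟨ξ, hξ, rfl⟩, hA⟩
          exact ⟨⟨⟨ξ, hξ⟩, hA⟩, rfl⟩)
    exact ⟨(e.trans e').symm⟩

theorem isBranch_path (hκ : κ.IsRegular) (h : IsTwoCardinal κ μ) (α : SuccOrd κ) :
    IsBranch κ (kurepaTree h) (path h α) := by
  have := h.isBranch_path_inter hκ (α := α) subset_rfl
    fun ξ hξ => ⟨ξ, hξ, le_rfl, α, ξ, hξ, rfl⟩
  rwa [Set.inter_eq_left.2 (h.path_subset α)] at this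

theorem path_injective (hκ : κ.IsRegular) (h : IsTwoCardinal κ μ) :
    Function.Injective (path h) := by
  intro α β heq
  obtain ⟨X, hX, hα⟩ : α ∈ ⋃₀ μ := h.covers ▸ Set.mem_univ α
  obtain ⟨Y, hY, hβ⟩ : β ∈ ⋃₀ μ := h.covers ▸ Set.mem_univ β
  obtain ⟨Z, hZ, hXZ, hYZ⟩ := h.directed X hX Y hY
  refine h.kurepaFun_rank_injOn ⟨Z, hZ⟩ (hXZ hα) (hYZ hβ) ?_
  have hlt := (isSuccLimit_ord hκ.aleph0_le).succ_lt (h.rank_lt_ord hκ ⟨Z, hZ⟩)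
  have hmem : restr (kurepaFun h α) (Order.succ (rank h.wf ⟨Z, hZ⟩)) ∈ path h β :=
    heq ▸ ⟨_, hlt, rfl⟩
  obtain ⟨ζ, -, hζ⟩ := hmem
  exact (restr_subset_restr_iff.1 hζ.le).2 _ (Order.lt_succ _)

end IsTwoCardinal

namespace IsStationaryTwoCardinal

variable {κ : Cardinal.{u}} {μ : Set (Set (SuccOrd κ))}

theorem isKappaTree (hκ : κ.IsRegular) (h : IsStationaryTwoCardinal κ μ) :
    IsKappaTree κ (kurepaTree h.toIsTwoCardinal) where
  tree := h.isTree_of_subset subset_rfl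
  height_le := by
    rintro _ ⟨α, ξ, hξ, rfl⟩
    exact ⟨ξ, hξ, h.mem_level_kurepaTree α hξ⟩
  le_height := fun ξ hξ =>
    have ⟨α, _⟩ := exists_notMem_of_mem_smallSubsets (κ := κ) (X := ∅) (by
      change #(∅ : Set (SuccOrd κ)) < κ
      rw [mk_eq_zero]; exact hκ.pos)
    ⟨_, h.mem_level_kurepaTree α hξ⟩
  level_small := by
    intro ξ hξ
    obtain ⟨X, hX⟩ := h.exists_rank_ge hκ hξ
    have hsub : level (kurepaTree h.toIsTwoCardinal) ξ ⊆
        (fun α => restr (kurepaFun h.toIsTwoCardinal α) ξ) '' X := by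
      intro t ht
      obtain ⟨β, ζ, hζ, rfl⟩ := ht.1
      obtain rfl := eq_of_mem_level ht (h.mem_level_kurepaTree β hζ)
      obtain ⟨α, hα, heq⟩ := h.exists_mem_kurepaFun_eq X
        (h.exists_mem_rank_ge hκ β (h.rank_lt_ord hκ X))
      exact ⟨α, hα, restr_congr fun η hη => (heq η (hη.le.trans hX)).symm⟩
    calc Cardinal.lift.{u, u + 1} #(level (kurepaTree h.toIsTwoCardinal) ξ)
        ≤ Cardinal.lift.{u, u + 1} #((fun α => restr (kurepaFun h.toIsTwoCardinal α) ξ) ''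
            (X : Set (SuccOrd κ))) := lift_le.2 (mk_le_mk_of_subset hsub)
      _ ≤ Cardinal.lift.{u + 1, u} #(X : Set (SuccOrd κ)) := mk_image_le_lift
      _ < Cardinal.lift.{u + 1, u} κ := lift_lt.2 (h.small X.2)

/-- Every `κ`-tree `A` included in the tree meets the set of restrictions of some `f_α` in an
unbounded set. Otherwise, for each `α`, no `f_α ↾ ζ` with `ζ ≥ ψ α` lies in `A`. Stationarity gives
a member `X`, of rank `δ` say, such that for all `α ∈ X` the elements of `A` on level `ψ α` have
length at most `δ`. An element of `A` on level `δ` follows some `f_α`, `α ∈ X`, up to `δ`, so its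
predecessor on level `ψ α` is a restriction of `f_α` to an ordinal at least `ψ α`. -/
theorem exists_unbounded_restr_mem (hκ : κ.IsRegular) (h : IsStationaryTwoCardinal κ μ)
    {A : Set (Set (Ordinal.{u} × Ordinal.{u}))} (hA : A ⊆ kurepaTree h.toIsTwoCardinal)
    (hAtree : IsKappaTree κ A) :
    ∃ α, ∀ ξ < κ.ord, ∃ ζ < κ.ord, ξ ≤ ζ ∧ restr (kurepaFun h.toIsTwoCardinal α) ζ ∈ A := by
  by_contra! hcon
  choose ψ hψ hψA using hcon
  have hlen : ∀ ξ < κ.ord, sSup (len '' level A ξ) < κ.ord := by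
    intro ξ hξ
    refine sSup_lt_of_lt_cof ?_ ?_
    · rw [← lift_cof, hκ.cof_ord]
      refine mk_image_le.trans_lt ?_
      rw [← Cardinal.lift_id'.{u, u + 1} #(level A ξ)]
      exact hAtree.level_small ξ hξ
    · rintro _ ⟨t, ht, rfl⟩
      exact (h.eq_restr_len (hA ht.1)).1
  have hle_len : ∀ ξ, ∀ t ∈ level A ξ, ξ ≤ len t := by
    rintro ξ t ⟨ht, ⟨e⟩⟩
    refine le_of_strictMono_Iio (f := fun η => len (e.symm η : Set (Ordinal.{u} × Ordinal.{u})))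
      (fun η θ hlt => ?_) fun η => ?_
    · exact h.len_lt_len (hA (e.symm η).2.1) (hA (e.symm θ).2.1) (e.symm.lt_iff_lt.2 hlt)
    · exact h.len_lt_len (hA (e.symm η).2.1) (hA ht) (e.symm η).2.2
  obtain ⟨X, hX⟩ := h.exists_forall_mem_le_rank hκ
    (fun α => max (sSup (len '' level A (ψ α))) (Order.succ (ψ α)))
    fun α => max_lt (hlen _ (hψ α)) ((isSuccLimit_ord hκ.aleph0_le).succ_lt (hψ α))
  have hδ := h.rank_lt_ord hκ X
  obtain ⟨t, ht⟩ := hAtree.le_height _ hδ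
  obtain ⟨-, β, htβ⟩ := h.eq_restr_len (hA ht.1)
  obtain ⟨α, hα, heq⟩ := h.exists_mem_kurepaFun_eq X (h.exists_mem_rank_ge hκ β hδ)
  have hXα := max_le_iff.1 (hX α hα)
  obtain ⟨s, hs, hst⟩ := exists_lt_mem_level ht (Order.succ_le_iff.1 hXα.2)
  have hslen : len s ≤ rank h.wf X := by
    refine le_trans (le_csSup ⟨κ.ord, ?_⟩ (Set.mem_image_of_mem len hs)) hXα.1
    rintro _ ⟨r, hr, rfl⟩
    exact (h.eq_restr_len (hA hr.1)).1.le
  rw [htβ] at hst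
  have hsα : s = restr (kurepaFun h.toIsTwoCardinal α) (len s) :=
    (h.eq_restr_of_lt (hA hs.1) hst).trans (restr_congr fun η hη => heq η (hη.le.trans hslen))
  exact hψA α (len s) (hslen.trans_lt hδ) (hle_len _ s hs) (hsα ▸ hs.1)

/-- The branches of length `κ` are exactly the sets of restrictions of the functions `f_α`, because
a branch is itself a `κ`-tree included in the tree. -/
theorem setOf_isBranch_eq_range (hκ : κ.IsRegular) (h : IsStationaryTwoCardinal κ μ) :
    {b | IsBranch κ (kurepaTree h.toIsTwoCardinal) b} = Set.range h.path := by
  ext b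
  refine ⟨fun hb => ?_, ?_⟩
  · obtain ⟨α, hα⟩ := h.exists_unbounded_restr_mem hκ hb.subset
      (hb.isKappaTree (one_lt_aleph0.trans_le hκ.aleph0_le))
    -- The part of `b` on the path of `α` is a branch of `b`, hence all of the chain `b`.
    have hsub := (h.isBranch_path_inter hκ hb.subset hα).maximal b subset_rfl hb.chain
      Set.inter_subset_right
    exact ⟨α, hb.maximal _ (h.path_subset α) (h.path_isChain α) (Set.inter_eq_right.1 hsub.symm)⟩
  · rintro ⟨α, rfl⟩
    exact h.isBranch_path hκ α

theorem lift_mk_branches (hκ : κ.IsRegular) (h : IsStationaryTwoCardinal κ μ) :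
    Cardinal.lift.{u} #{b | IsBranch κ (kurepaTree h.toIsTwoCardinal) b} =
      Cardinal.lift.{u + 1} (Order.succ κ) := by
  rw [h.setOf_isBranch_eq_range hκ, mk_range_eq_of_injective (h.path_injective hκ),
    mk_ord_toType]

end IsStationaryTwoCardinal

end TwoCardinal

theorem mainTheorem5 (κ : Cardinal.{u}) (hκ : κ.IsRegular)
    (μ : Set (Set (TwoCardinal.SuccOrd κ)))
    (hμ : TwoCardinal.IsStationaryTwoCardinal κ μ) :
    TwoCardinal.IsKurepaTree κ (TwoCardinal.kurepaTree hμ.toIsTwoCardinal) ∧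
    Cardinal.lift.{u} #{b : Set (Set (Ordinal.{u} × Ordinal.{u})) |
      TwoCardinal.IsBranch κ (TwoCardinal.kurepaTree hμ.toIsTwoCardinal) b} =
        Cardinal.lift.{u + 1} (Order.succ κ) ∧
    ∀ A ⊆ TwoCardinal.kurepaTree hμ.toIsTwoCardinal, ¬ TwoCardinal.IsAronszajnTree κ A := by
  refine ⟨⟨hμ.isKappaTree hκ, (hμ.lift_mk_branches hκ).ge⟩, hμ.lift_mk_branches hκ,
    fun A hA hAr => ?_⟩
  obtain ⟨α, hα⟩ := hμ.exists_unbounded_restr_mem hκ hA hAr.toIsKappaTree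
  exact hAr.no_branch _ (hμ.isBranch_path_inter hκ hA hα)
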